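/- Let $G=(0,1)$ and let $C$ be the space of continuous functions $x_\cdot:[0,\infty)\to\mathbb R$ with Wiener measure $W$. Let $\sigma,\sigma_1>0$ be constants and let $\pi_0\in C_0^\infty(G)$ be a probability density. For continuous $y_\cdot:[0,\infty)\to\mathbb R$ put $y_r:=y_0$ for $r\le 0$, and for $t\ge0$, $x\in\mathbb R$, $x_\cdot\in C$ define $$\tau(t,x,x_\cdot,y_\cdot)=\inf\{s\ge0: x+\sigma_1x_s\notin(\sigma y_{t-s},\sigma y_{t-s}+1)\},$$ $$\gamma(t,x,x_\cdot,y_\cdot)=\inf\{s\ge0: x+\sigma_1x_s\le\sigma y_{t-s}\}$$ (with $\inf\emptyset=\infty$), and $$u_t(y_\cdot,x)=\int_C(\pi_0I_G)(x+\sigma_1x_t)\,I_{\{\tau(t,x,x_\cdot,y_\cdot)\ge t\}}\,W(dx_\cdot),$$ $$v_t(y_\cdot,x)=\int_C(\pi_0I_G)(x+\sigma_1x_t)\,I_{\{\gamma(t,x,x_\cdot,y_\cdot)\ge t\}}\,W(dx_\cdot).$$ These are the probabilistic solutions of $\partial_tu=\tfrac12\sigma_1^2D^2u$ with initial value $\pi_0I_G$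 and zero lateral boundary values in the domains $\{\sigma y_t<x<\sigma y_t+1\}$ and $\{x>\sigma y_t\}$, respectively. **Lemma 3.2.** There is an absolute constant $\varepsilon_0>0$ such that, if $\sigma_1/\sigma<\varepsilon_0$ and $b$ is a one-dimensional standard Wiener process, then for each $T\in(0,\infty)$, almost surely, $$\lim_{x\downarrow\sigma b_T}\frac{v_T(b_\cdot,x)}{x-\sigma b_T}=0\qquad\text{and}\qquad\lim_{x\downarrow\sigma b_T}\frac{u_T(b_\cdot,x)}{x-\sigma b_T}=0.$$ -/

import Mathlib

open MeasureTheory ProbabilityTheory Filter Topology Set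
open scoped NNReal ENNReal ContDiff

namespace BrownianBoundary

/-- The path space `C = C([0, ∞), ℝ)` carries the σ-algebra generated by the coordinates. -/
instance pathMeasurableSpace : MeasurableSpace C(ℝ≥0, ℝ) :=
  MeasurableSpace.comap (fun (X : C(ℝ≥0, ℝ)) (t : ℝ≥0) => X t) MeasurableSpace.pi

/-- `W` is the Wiener measure on path space: under `W` the coordinate process is a standard
Brownian motion (this determines `W`, since its finite-dimensional laws are prescribed). -/
def IsWienerMeasure (W : Measure C(ℝ≥0, ℝ)) : Prop :=
  IsBrownianReal (fun (t : ℝ≥0) (X : C(ℝ≥0, ℝ)) => X t) W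

/-- The first time `s ≥ 0` at which `x + σ₁ X_s` is outside
`(σ y_{t-s}, σ y_{t-s} + 1)`; it is `∞` if there is no such time. Subtraction in `ℝ≥0` is
truncated at `0`, which is the convention `y_r = y_0` for `r ≤ 0`. -/
noncomputable def stripExitTime (σ σ₁ : ℝ) (t : ℝ≥0) (x : ℝ) (X y : ℝ≥0 → ℝ) : ℝ≥0∞ :=
  ⨅ (s : ℝ≥0) (_ : x + σ₁ * X s ∉ Ioo (σ * y (t - s)) (σ * y (t - s) + 1)), (s : ℝ≥0∞)

/-- The first time `s ≥ 0` at which `x + σ₁ X_s ≤ σ y_{t-s}` (`∞` if there is none), with the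
same convention `y_r = y_0` for `r ≤ 0`. -/
noncomputable def lowerHitTime (σ σ₁ : ℝ) (t : ℝ≥0) (x : ℝ) (X y : ℝ≥0 → ℝ) : ℝ≥0∞ :=
  ⨅ (s : ℝ≥0) (_ : x + σ₁ * X s ≤ σ * y (t - s)), (s : ℝ≥0∞)

/-- The probabilistic solution, at `(t, x)`, of the heat equation `∂ₜu = (1/2) σ₁² D²u` in the
strip `σ y_t < x < σ y_t + 1`, with zero lateral values and with initial value `π₀` on `(0, 1)`. -/
noncomputable def stripSolution (W : Measure C(ℝ≥0, ℝ)) (π₀ : ℝ → ℝ) (σ σ₁ : ℝ)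
    (y : ℝ≥0 → ℝ) (t : ℝ≥0) (x : ℝ) : ℝ :=
  ∫ X : C(ℝ≥0, ℝ),
    {X : C(ℝ≥0, ℝ) | (t : ℝ≥0∞) ≤ stripExitTime σ σ₁ t x X y}.indicator
      (fun X => (Ioo (0 : ℝ) 1).indicator π₀ (x + σ₁ * X t)) X ∂W

/-- The probabilistic solution, at `(t, x)`, of the heat equation `∂ₜv = (1/2) σ₁² D²v` in the
one-sided domain `x > σ y_t`, with zero values on the lateral boundary and with initial value
`π₀` on `(0, 1)` and zero outside. -/
noncomputable def halfLineSolution (W : Measure C(ℝ≥0, ℝ)) (π₀ : ℝ → ℝ) (σ σ₁ : ℝ)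
    (y : ℝ≥0 → ℝ) (t : ℝ≥0) (x : ℝ) : ℝ :=
  ∫ X : C(ℝ≥0, ℝ),
    {X : C(ℝ≥0, ℝ) | (t : ℝ≥0∞) ≤ lowerHitTime σ σ₁ t x X y}.indicator
      (fun X => (Ioo (0 : ℝ) 1).indicator π₀ (x + σ₁ * X t)) X ∂W

end BrownianBoundary

/-!
Write `δ = x - σ b_T` and `ε = σ₁ / σ`, and fix the path of `b`. A path `X` contributes to the
solutions at `(T, x)` only if `δ / σ + ε X_s + B_s > 0` for all `s < T`, where
`B_s = b_T - b_{T - s}` is again a Brownian motion. This condition is used only at the times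
`s_k = T / 4 ^ (k + 1)`, where it reads `δ / (σ √s_k) + ε Z_k + Y_k > 0` with the normalized values
`Z_k = X_{s_k} / √s_k` and `Y_k = B_{s_k} / √s_k`. Both `Z` and `Y` are centred Gaussian sequences
with covariances `2 ^ (-|j - k|)` (`IsDyadicGaussian`).

The environment `Y` has independent identically distributed innovations `Y_k - Y_{k+1} / 2`, so the
strong law of large numbers shows that almost surely the negative parts of `Y_0, …, Y_{N-1}` sum to
at least `c N` for large `N`, with an absolute constant `c > 0`
(`IsDyadicGaussian.ae_eventually_le_sum_negPart`). Take `N` of order `log₂ (σ √T / δ)`, so that the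
terms `δ / (σ √s_k)` with `k < N` sum to at most `2`. Adding the survival conditions over those
`k < N` with `Y_k < 0` shows that the sum `G` of the corresponding `Z_k` is at least
`(c N - 2) / ε`. Since the correlations are summable, `Var G ≤ 3 N`, hence
`E exp G ≤ exp (3 N / 2)`, and the survival probability is at most
`exp (3 N / 2 - (c N - 2) / ε)` (`integral_survival_le`). For `ε < c / 3` this is `o (2 ^ (-N))`,
that is, `o (δ)` (`tendsto_div_of_survival_bound`).
-/

namespace BrownianBoundary

/-! ### Gaussian sequences with covariances `2 ^ (-|j - k|)` -/

/-- A centred Gaussian sequence with covariances `cov (Y j, Y k) = 2 ^ (-|j - k|)`, that is, a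
stationary autoregressive sequence with coefficient `1 / 2`, read backwards in `k`. This is the law
of a Brownian motion sampled at the times `T / 4 ^ (k + 1)` and normalized to unit variance. -/
structure IsDyadicGaussian {Ω : Type*} [MeasurableSpace Ω] (Y : ℕ → Ω → ℝ) (P : Measure Ω) :
    Prop where
  isGaussianProcess : IsGaussianProcess Y P
  integral_eq_zero : ∀ k, ∫ w, Y k w ∂P = 0
  covariance_eq : ∀ j n, cov[Y j, Y (j + n); P] = (1 / 2) ^ n

/-- The time `T / 4 ^ (k + 1)`; the exponent starts at `1` so that these times are less than `T`. -/
noncomputable def dyadicTime (T : ℝ≥0) (k : ℕ) : ℝ≥0 := T / 4 ^ (k + 1)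

lemma dyadicTime_lt {T : ℝ≥0} (hT : 0 < T) (k : ℕ) : dyadicTime T k < T :=
  div_lt_self hT (one_lt_pow₀ (by norm_num) (by omega))

lemma dyadicTime_pos {T : ℝ≥0} (hT : 0 < T) (k : ℕ) : 0 < dyadicTime T k := by
  unfold dyadicTime; positivity

lemma sqrt_dyadicTime (T : ℝ≥0) (k : ℕ) :
    √(dyadicTime T k : ℝ) = √(T : ℝ) * (1 / 2) ^ (k + 1) := by
  rw [Real.sqrt_eq_iff_mul_self_eq (by positivity) (by positivity), mul_mul_mul_comm,
    Real.mul_self_sqrt (by positivity), ← mul_pow]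
  simp only [dyadicTime, NNReal.coe_div, NNReal.coe_pow, NNReal.coe_ofNat]
  rw [div_eq_mul_inv, ← inv_pow]
  norm_num

section

variable {Ω : Type*} [MeasurableSpace Ω] {P : Measure Ω}

lemma isDyadicGaussian_of_covariance {T : ℝ≥0} (hT : 0 < T) {G : ℝ≥0 → Ω → ℝ}
    (hG : IsGaussianProcess G P) (hmean : ∀ s, ∫ w, G s w ∂P = 0)
    (hcov : ∀ s t, s ≤ t → t ≤ T → cov[G s, G t; P] = s) :
    IsDyadicGaussian (fun k w => G (dyadicTime T k) w / √(dyadicTime T k : ℝ)) P where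
  isGaussianProcess := by
    simpa [div_eq_inv_mul, Function.comp_def] using
      (hG.comp_right (dyadicTime T)).smul fun k => (√(dyadicTime T k : ℝ))⁻¹
  integral_eq_zero k := by rw [integral_div, hmean, zero_div]
  covariance_eq j n := by
    have hle : dyadicTime T (j + n) ≤ dyadicTime T j := by
      unfold dyadicTime
      gcongr
      · norm_num
      · omega
    rw [covariance_fun_div_left, covariance_fun_div_right, covariance_comm,
      hcov _ _ hle (dyadicTime_lt hT j).le, sqrt_dyadicTime, div_right_comm]
    nth_rewrite 1 [← Real.mul_self_sqrt (dyadicTime T (j + n)).coe_nonneg]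
    simp only [sqrt_dyadicTime]
    have : (0 : ℝ) < √(T : ℝ) := by positivity
    rw [show j + n + 1 = (j + 1) + n by ring, pow_add]
    field_simp

/-- Brownian motion sampled at the times `T / 4 ^ (k + 1)`. -/
lemma isDyadicGaussian_brownian {T : ℝ≥0} (hT : 0 < T) {X : ℝ≥0 → Ω → ℝ}
    (hX : IsPreBrownianReal X P) :
    IsDyadicGaussian (fun k w => X (dyadicTime T k) w / √(dyadicTime T k : ℝ)) P :=
  isDyadicGaussian_of_covariance hT hX.isGaussianProcess hX.integral_eval
    fun s t hst _ => by rw [hX.covariance_eval, min_eq_left hst]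

/-- The time reversal `s ↦ b T - b (T - s)` of a Brownian motion, sampled at the times
`T / 4 ^ (k + 1)`. -/
lemma isDyadicGaussian_reversal {T : ℝ≥0} (hT : 0 < T) {b : ℝ≥0 → Ω → ℝ}
    (hb : IsPreBrownianReal b P) :
    IsDyadicGaussian
      (fun k w => (b T w - b (T - dyadicTime T k) w) / √(dyadicTime T k : ℝ)) P := by
  have hP : IsProbabilityMeasure P := hb.isGaussianProcess.isProbabilityMeasure
  have hL (t : ℝ≥0) : MemLp (b t) 2 P := (hb.isGaussianProcess.hasGaussianLaw_eval t).memLp_two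
  refine isDyadicGaussian_of_covariance (G := fun s w => b T w - b (T - s) w) hT ?_
    (fun s => ?_) (fun s t hst htT => ?_)
  · classical
    exact hb.isGaussianProcess.of_isGaussianProcess fun s => ⟨{T, T - s},
      { toFun x := x ⟨T, by simp⟩ - x ⟨T - s, by simp⟩
        map_add' x y := by simp; abel
        map_smul' c x := by simp; ring }, by simp⟩
  · rw [integral_sub (hb.integrable_eval _) (hb.integrable_eval _), hb.integral_eval,
      hb.integral_eval, sub_zero]
  · rw [covariance_fun_sub_fun_sub (hL _) (hL _) (hL _) (hL _)]
    simp only [hb.covariance_eval]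
    rw [min_self, min_eq_right tsub_le_self, min_eq_left tsub_le_self,
      min_eq_right (tsub_le_tsub_left hst T), NNReal.coe_sub htT, NNReal.coe_sub (hst.trans htT)]
    ring

namespace IsDyadicGaussian

variable {Y : ℕ → Ω → ℝ}

lemma memLp_two (hY : IsDyadicGaussian Y P) (k : ℕ) : MemLp (Y k) 2 P :=
  (hY.isGaussianProcess.hasGaussianLaw_eval k).memLp_two

lemma variance_eq_one (hY : IsDyadicGaussian Y P) (k : ℕ) : Var[Y k; P] = 1 := by
  rw [← covariance_self (hY.isGaussianProcess.aemeasurable k)]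
  simpa using hY.covariance_eq k 0

/-! ### Exponential moments -/

/-- The correlations are summable, so that the variance of a sum of `N` terms with weights in
`[0, 1]` grows only linearly. -/
lemma variance_sum_le (hY : IsDyadicGaussian Y P) {a : ℕ → ℝ} (ha0 : ∀ k, 0 ≤ a k)
    (ha1 : ∀ k, a k ≤ 1) (N : ℕ) :
    Var[fun w => ∑ k ∈ Finset.range N, a k * Y k w; P] ≤ 3 * N := by
  have hP : IsProbabilityMeasure P := hY.isGaussianProcess.isProbabilityMeasure
  have hL (k : ℕ) : MemLp (fun w => a k * Y k w) 2 P := (hY.memLp_two k).const_mul _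
  induction N with
  | zero =>
    simp only [Finset.range_zero, Finset.sum_empty, Nat.cast_zero, mul_zero]
    exact (variance_zero P).le
  | succ N ih =>
    have hcov : cov[fun w => ∑ k ∈ Finset.range N, a k * Y k w, fun w => a N * Y N w; P] ≤ 1 := by
      rw [covariance_fun_sum_left' (fun k _ => hL k) (hL N)]
      calc ∑ k ∈ Finset.range N, cov[fun w => a k * Y k w, fun w => a N * Y N w; P]
          ≤ ∑ k ∈ Finset.range N, (1 / 2 : ℝ) ^ (N - k) := by
            refine Finset.sum_le_sum fun k hk => ?_
            have hkN : k + (N - k) = N := by have := Finset.mem_range.1 hk; omega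
            have hc := hY.covariance_eq k (N - k)
            rw [hkN] at hc
            rw [covariance_const_mul_left, covariance_const_mul_right, hc, ← mul_assoc]
            exact mul_le_of_le_one_left (by positivity)
              (mul_le_one₀ (ha1 k) (ha0 N) (ha1 N))
        _ = 1 - (1 / 2 : ℝ) ^ N := by
            clear ih
            induction N with
            | zero => simp
            | succ N ih =>
              rw [Finset.sum_range_succ, Finset.sum_congr rfl fun k hk => by
                rw [Nat.succ_sub (Finset.mem_range.1 hk).le, pow_succ], ← Finset.sum_mul, ih]
              simp only [add_tsub_cancel_left]
              ring
        _ ≤ 1 := by linarith [pow_nonneg (by norm_num : (0 : ℝ) ≤ 1 / 2) N]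
    have hvar : Var[fun w => a N * Y N w; P] ≤ 1 := by
      rw [variance_const_mul, hY.variance_eq_one, mul_one]
      exact pow_le_one₀ (ha0 N) (ha1 N)
    simp only [Finset.sum_range_succ]
    rw [variance_fun_add (memLp_finsetSum _ fun k _ => hL k) (hL N)]
    push_cast
    linarith

lemma map_sum_eq_gaussianReal (hY : IsDyadicGaussian Y P) (a : ℕ → ℝ) (N : ℕ) :
    P.map (fun w => ∑ k ∈ Finset.range N, a k * Y k w) =
      gaussianReal 0 (Var[fun w => ∑ k ∈ Finset.range N, a k * Y k w; P]).toNNReal := by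
  have hP : IsProbabilityMeasure P := hY.isGaussianProcess.isProbabilityMeasure
  have hlaw : HasGaussianLaw (fun w => ∑ k ∈ Finset.range N, a k * Y k w) P :=
    (hY.isGaussianProcess.smul a).hasGaussianLaw_fun_sum
  rw [hlaw.map_eq_gaussianReal, integral_finsetSum _ fun k _ =>
    ((hY.memLp_two k).integrable one_le_two).const_mul _]
  simp [integral_const_mul, hY.integral_eq_zero]

lemma integrable_exp_sum (hY : IsDyadicGaussian Y P) (a : ℕ → ℝ) (N : ℕ) :
    Integrable (fun w => Real.exp (∑ k ∈ Finset.range N, a k * Y k w)) P := by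
  have h := mgf_gaussianReal (hY.map_sum_eq_gaussianReal a N) 1
  have hP : IsProbabilityMeasure P := hY.isGaussianProcess.isProbabilityMeasure
  have := (mgf_pos_iff (t := 1) (μ := P)
    (X := fun w => ∑ k ∈ Finset.range N, a k * Y k w)).1 (h ▸ Real.exp_pos _)
  simpa using this

lemma integral_exp_sum_le (hY : IsDyadicGaussian Y P) {a : ℕ → ℝ} (ha0 : ∀ k, 0 ≤ a k)
    (ha1 : ∀ k, a k ≤ 1) (N : ℕ) :
    ∫ w, Real.exp (∑ k ∈ Finset.range N, a k * Y k w) ∂P ≤ Real.exp (3 / 2 * N) := by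
  have h := mgf_gaussianReal (hY.map_sum_eq_gaussianReal a N) 1
  simp only [mgf, one_mul] at h
  rw [h, Real.coe_toNNReal _ (variance_nonneg _ _)]
  have := hY.variance_sum_le ha0 ha1 N
  gcongr
  linarith

/-! ### Linear growth of the negative parts -/

lemma isGaussianProcess_innovation (hY : IsDyadicGaussian Y P) :
    IsGaussianProcess (fun k w => Y k w - Y (k + 1) w / 2) P := by
  classical
  exact hY.isGaussianProcess.of_isGaussianProcess fun k => ⟨{k, k + 1},
    { toFun x := x ⟨k, by simp⟩ - x ⟨k + 1, by simp⟩ / 2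
      map_add' x y := by simp; ring
      map_smul' c x := by simp; ring }, by simp⟩

lemma covariance_innovation (hY : IsDyadicGaussian Y P) (j k : ℕ) :
    cov[fun w => Y j w - Y (j + 1) w / 2, fun w => Y k w - Y (k + 1) w / 2; P] =
      if j = k then 3 / 4 else 0 := by
  have hP : IsProbabilityMeasure P := hY.isGaussianProcess.isProbabilityMeasure
  have hL (k : ℕ) : MemLp (Y k) 2 P := hY.memLp_two k
  have hL' (k : ℕ) : MemLp (fun w => Y k w / 2) 2 P := by
    simpa [div_eq_mul_inv] using (hL k).mul_const (2⁻¹ : ℝ)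
  wlog hjk : j ≤ k generalizing j k
  · rw [covariance_comm, this k j (by omega)]
    simp only [eq_comm]
  obtain ⟨n, rfl⟩ := Nat.exists_eq_add_of_le hjk
  rw [covariance_fun_sub_fun_sub (hL _) (hL' _) (hL _) (hL' _)]
  simp only [covariance_fun_div_left, covariance_fun_div_right]
  rw [add_assoc j n 1, hY.covariance_eq j n, hY.covariance_eq j (n + 1),
    show j + (n + 1) = j + 1 + n by ring, hY.covariance_eq (j + 1) n]
  rcases n with _ | n
  · rw [covariance_comm, add_zero, hY.covariance_eq j 1]
    norm_num
  · rw [show j + (n + 1) = j + 1 + n by ring, hY.covariance_eq (j + 1) n]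
    simp only [show ¬ j = j + 1 + n by omega, if_false]
    ring

lemma hasLaw_innovation (hY : IsDyadicGaussian Y P) (k : ℕ) :
    HasLaw (fun w => Y k w - Y (k + 1) w / 2) (gaussianReal 0 (3 / 4)) P where
  aemeasurable := hY.isGaussianProcess_innovation.aemeasurable k
  map_eq := by
    have hP : IsProbabilityMeasure P := hY.isGaussianProcess.isProbabilityMeasure
    have hI (k : ℕ) : Integrable (Y k) P := (hY.memLp_two k).integrable one_le_two
    rw [(hY.isGaussianProcess_innovation.hasGaussianLaw_eval k).map_eq_gaussianReal,
      ← covariance_self (hY.isGaussianProcess_innovation.aemeasurable k),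
      hY.covariance_innovation, integral_sub (hI _) ((hI _).div_const _), integral_div,
      hY.integral_eq_zero, hY.integral_eq_zero]
    congr 1
    · simp
    · simp [Real.toNNReal_div]

lemma pairwise_indepFun_innovation (hY : IsDyadicGaussian Y P) :
    Pairwise (Function.onFun (fun f g => IndepFun f g P)
      fun k w => Y k w - Y (k + 1) w / 2) := fun j k hjk =>
  hY.isGaussianProcess_innovation.hasGaussianLaw_prodMk.indepFun_of_covariance_eq_zero
    (by rw [hY.covariance_innovation, if_neg hjk])

lemma ae_tendsto_average_innovation (hY : IsDyadicGaussian Y P) :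
    ∀ᵐ w ∂P, Tendsto (fun N : ℕ => (∑ k ∈ Finset.range N, (Y k w - Y (k + 1) w / 2)) / N)
      atTop (𝓝 0) := by
  have hint : Integrable (fun w => Y 0 w - Y 1 w / 2) P :=
    (hY.isGaussianProcess_innovation.hasGaussianLaw_eval 0).integrable
  have h := strong_law_ae_real (fun k w => Y k w - Y (k + 1) w / 2) hint
    hY.pairwise_indepFun_innovation
    fun k => ⟨(hY.hasLaw_innovation k).aemeasurable, (hY.hasLaw_innovation 0).aemeasurable,
      (hY.hasLaw_innovation k).map_eq.trans (hY.hasLaw_innovation 0).map_eq.symm⟩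
  rwa [(hY.hasLaw_innovation 0).integral_eq, integral_id_gaussianReal] at h

lemma ae_tendsto_average_abs_innovation (hY : IsDyadicGaussian Y P) :
    ∀ᵐ w ∂P, Tendsto (fun N : ℕ => (∑ k ∈ Finset.range N, |Y k w - Y (k + 1) w / 2|) / N)
      atTop (𝓝 (∫ x, |x| ∂gaussianReal 0 (3 / 4))) := by
  have hint : Integrable (fun w => Y 0 w - Y 1 w / 2) P :=
    (hY.isGaussianProcess_innovation.hasGaussianLaw_eval 0).integrable
  have h := strong_law_ae_real (fun k w => |Y k w - Y (k + 1) w / 2|) hint.abs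
    (fun j k hjk => (hY.pairwise_indepFun_innovation hjk).comp measurable_abs measurable_abs)
    fun k => IdentDistrib.comp (u := fun x : ℝ => |x|)
      ⟨(hY.hasLaw_innovation k).aemeasurable, (hY.hasLaw_innovation 0).aemeasurable,
        (hY.hasLaw_innovation k).map_eq.trans (hY.hasLaw_innovation 0).map_eq.symm⟩
      measurable_abs
  have he := (hY.hasLaw_innovation 0).integral_comp (f := fun x : ℝ => |x|)
    continuous_abs.aestronglyMeasurable
  simp only [Function.comp_def] at he
  rwa [he] at h

/-- The second moments `E (Y N / N) ^ 2 = 1 / N ^ 2` are summable. -/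
lemma ae_tendsto_div_atTop (hY : IsDyadicGaussian Y P) :
    ∀ᵐ w ∂P, Tendsto (fun N : ℕ => Y N w / N) atTop (𝓝 0) := by
  have hP : IsProbabilityMeasure P := hY.isGaussianProcess.isProbabilityMeasure
  have hsq (k : ℕ) : ∫ w, Y k w ^ 2 ∂P = 1 := by
    have := variance_of_integral_eq_zero (hY.isGaussianProcess.aemeasurable k)
      (hY.integral_eq_zero k)
    rw [hY.variance_eq_one] at this
    exact this.symm
  have hmom (N : ℕ) : ∫⁻ w, ENNReal.ofReal ((Y N w / N) ^ 2) ∂P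
      = ENNReal.ofReal (1 / (N : ℝ) ^ 2) := by
    rw [← ofReal_integral_eq_lintegral_ofReal]
    · simp only [div_pow]
      rw [integral_div, hsq]
    · simp only [div_pow]
      exact (hY.memLp_two N).integrable_sq.div_const _
    · exact ae_of_all _ fun w => sq_nonneg _
  have hfin : ∫⁻ w, ∑' N : ℕ, ENNReal.ofReal ((Y N w / N) ^ 2) ∂P ≠ ⊤ := by
    rw [lintegral_tsum fun N =>
      (((hY.isGaussianProcess.aemeasurable N).div_const _).pow_const 2).ennreal_ofReal]
    simp only [hmom]
    exact (Real.summable_one_div_nat_pow.2 one_lt_two).tsum_ofReal_ne_top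
  filter_upwards [ae_lt_top' (AEMeasurable.tsum fun N =>
    (((hY.isGaussianProcess.aemeasurable N).div_const _).pow_const 2).ennreal_ofReal) hfin]
    with w hw
  have h0 := (ENNReal.tendsto_toReal ENNReal.zero_ne_top).comp
    (ENNReal.tendsto_atTop_zero_of_tsum_ne_top hw.ne)
  simp only [Function.comp_def, ENNReal.toReal_ofReal (sq_nonneg _), ENNReal.toReal_zero] at h0
  have h1 := h0.sqrt
  simp only [Real.sqrt_sq_eq_abs, Real.sqrt_zero] at h1
  exact (tendsto_zero_iff_abs_tendsto_zero _).2 h1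

end IsDyadicGaussian

end

lemma integral_abs_gaussianReal_pos : 0 < ∫ x, |x| ∂gaussianReal 0 (3 / 4) := by
  have hint : Integrable (fun x : ℝ => x) (gaussianReal 0 (3 / 4)) :=
    (memLp_id_gaussianReal 1).integrable le_rfl
  rw [integral_pos_iff_support_of_nonneg (fun x => abs_nonneg x) hint.abs]
  have hs : Function.support (fun x : ℝ => |x|) = {0}ᶜ := by ext; simp
  have hna : NullSingletonClass (gaussianReal 0 (3 / 4)) := nullSingletonClass_gaussianReal (by norm_num)
  rw [hs, prob_compl_eq_one_sub (measurableSet_singleton _), measure_singleton]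
  simp

/-- If the innovations `y k - y (k + 1) / 2` average to zero and their absolute values average to
`m`, then the recursion transfers both facts to `y` itself, up to boundary terms: the average of
`y` tends to zero and that of `|y|` is asymptotically at least `2 m / 3`. Hence the negative parts
have lower average at least `m / 3`. -/
lemma eventually_le_sum_negPart {y : ℕ → ℝ} {m : ℝ} (hm : 0 < m)
    (h0 : Tendsto (fun N : ℕ => (∑ k ∈ Finset.range N, (y k - y (k + 1) / 2)) / N) atTop (𝓝 0))
    (h1 : Tendsto (fun N : ℕ => (∑ k ∈ Finset.range N, |y k - y (k + 1) / 2|) / N) atTop (𝓝 m))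
    (h2 : Tendsto (fun N : ℕ => y N / N) atTop (𝓝 0)) :
    ∀ᶠ N : ℕ in atTop, m / 4 * N ≤ ∑ k ∈ Finset.range N, max (-y k) 0 := by
  have hsum (N : ℕ) : ∑ k ∈ Finset.range N, (y k - y (k + 1) / 2)
      = (∑ k ∈ Finset.range N, y k) / 2 + (y 0 - y N) / 2 := by
    induction N with
    | zero => simp
    | succ N ih => rw [Finset.sum_range_succ, ih, Finset.sum_range_succ]; ring
  have habs (N : ℕ) : ∑ k ∈ Finset.range N, |y k - y (k + 1) / 2|
      ≤ 3 / 2 * (∑ k ∈ Finset.range N, |y k|) + |y N| / 2 - |y 0| / 2 := by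
    induction N with
    | zero => simp
    | succ N ih =>
      rw [Finset.sum_range_succ, Finset.sum_range_succ]
      have h3 := abs_sub (y N) (y (N + 1) / 2)
      rw [abs_div, abs_two] at h3
      linarith
  have hneg (N : ℕ) : ∑ k ∈ Finset.range N, max (-y k) 0
      = (∑ k ∈ Finset.range N, |y k|) / 2 - (∑ k ∈ Finset.range N, y k) / 2 := by
    rw [Finset.sum_div, Finset.sum_div, ← Finset.sum_sub_distrib]
    refine Finset.sum_congr rfl fun k _ => ?_
    rcases le_total 0 (y k) with h | h
    · rw [abs_of_nonneg h, max_eq_right (by linarith)]; ring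
    · rw [abs_of_nonpos h, max_eq_left (by linarith)]; ring
  have hy0 : Tendsto (fun N : ℕ => |y 0| / (N : ℝ)) atTop (𝓝 0) :=
    tendsto_const_div_atTop_nhds_zero_nat _
  have habs2 := h2.abs
  rw [abs_zero] at habs2
  filter_upwards [h0.eventually_lt_const (show (0 : ℝ) < m / 100 by positivity),
    h1.eventually_const_lt (show m - m / 100 < m by linarith),
    habs2.eventually_lt_const (show (0 : ℝ) < m / 100 by positivity),
    hy0.eventually_lt_const (show (0 : ℝ) < m / 100 by positivity),
    eventually_gt_atTop 0] with N e0 e1 e2 e3 hN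
  have hN' : (0 : ℝ) < N := by exact_mod_cast hN
  rw [abs_div, Nat.abs_cast] at e2
  rw [div_lt_iff₀ hN'] at e0 e2 e3
  rw [lt_div_iff₀ hN'] at e1
  have := hsum N
  have := habs N
  rw [hneg]
  have := neg_abs_le (y N)
  have := le_abs_self (y N)
  have := neg_abs_le (y 0)
  have := abs_nonneg (y 0)
  nlinarith

lemma IsDyadicGaussian.ae_eventually_le_sum_negPart {Ω : Type*} [MeasurableSpace Ω]
    {P : Measure Ω} {Y : ℕ → Ω → ℝ} (hY : IsDyadicGaussian Y P) :
    ∀ᵐ w ∂P, ∀ᶠ N : ℕ in atTop, (∫ x, |x| ∂gaussianReal 0 (3 / 4)) / 4 * N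
      ≤ ∑ k ∈ Finset.range N, max (-Y k w) 0 := by
  filter_upwards [hY.ae_tendsto_average_innovation, hY.ae_tendsto_average_abs_innovation,
    hY.ae_tendsto_div_atTop] with w h0 h1 h2
  exact BrownianBoundary.eventually_le_sum_negPart integral_abs_gaussianReal_pos h0 h1 h2

/-! ### Survival probabilities in a fixed environment -/

/-- Chernoff's bound for the survival event `S` in a frozen environment `y`. On `S` the sum of the
negative parts of `y` must be compensated by `ε` times a sum of `Z`, up to the contribution `2` of
the starting point, and the exponential moments of the latter are controlled. The set
`S` need not be measurable, since the bound on its indicator is pointwise. -/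
lemma integral_survival_le {Ω : Type*} [MeasurableSpace Ω] {W : Measure Ω} {Z : ℕ → Ω → ℝ}
    (hZ : IsDyadicGaussian Z W) {S : Set Ω} {f : Ω → ℝ} {C : ℝ} (hf0 : ∀ X, 0 ≤ f X)
    (hfC : ∀ X, f X ≤ C) {y d : ℕ → ℝ} {ε : ℝ} (hε : 0 < ε) (hd0 : ∀ k, 0 ≤ d k)
    (hS : ∀ X ∈ S, ∀ k, 0 < d k + ε * Z k X + y k) {N : ℕ}
    (hd : ∑ k ∈ Finset.range N, d k ≤ 2) :
    ∫ X, S.indicator f X ∂W ≤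
      C * (Real.exp (-(∑ k ∈ Finset.range N, max (-y k) 0 - 2) / ε) * Real.exp (3 / 2 * N)) := by
  set s : ℝ := ∑ k ∈ Finset.range N, max (-y k) 0
  -- Only the scales at which the environment is negative are used.
  set a : ℕ → ℝ := fun k => if y k < 0 then 1 else 0 with ha
  have ha0 (k : ℕ) : 0 ≤ a k := by simp only [ha]; split_ifs <;> norm_num
  have ha1 (k : ℕ) : a k ≤ 1 := by simp only [ha]; split_ifs <;> norm_num
  have hpt (X : Ω) : S.indicator f X ≤
      C * (Real.exp (-(s - 2) / ε) * Real.exp (∑ k ∈ Finset.range N, a k * Z k X)) := by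
    have hC : 0 ≤ C := (hf0 X).trans (hfC X)
    by_cases hX : X ∈ S
    · rw [indicator_of_mem hX]
      refine (hfC X).trans (le_mul_of_one_le_right hC ?_)
      rw [← Real.exp_add, Real.one_le_exp_iff]
      have hle : s ≤ 2 + ε * ∑ k ∈ Finset.range N, a k * Z k X := by
        calc s ≤ ∑ k ∈ Finset.range N, (d k + ε * (a k * Z k X)) := by
              refine Finset.sum_le_sum fun k _ => ?_
              have h := hS X hX k
              by_cases hy : y k < 0
              · simp only [ha, hy, if_true]
                rw [max_eq_left (by linarith)]
                linarith
              · simp only [ha, hy, if_false]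
                rw [max_eq_right (by linarith)]
                simpa using hd0 k
          _ ≤ 2 + ε * ∑ k ∈ Finset.range N, a k * Z k X := by
              rw [Finset.sum_add_distrib, Finset.mul_sum]
              linarith
      rw [div_add' _ _ _ hε.ne']
      exact div_nonneg (by linarith) hε.le
    · rw [indicator_of_notMem hX]
      positivity
  have hint := hZ.integrable_exp_sum a N
  calc ∫ X, S.indicator f X ∂W
      ≤ ∫ X, C * (Real.exp (-(s - 2) / ε) *
          Real.exp (∑ k ∈ Finset.range N, a k * Z k X)) ∂W :=
        integral_mono_of_nonneg (ae_of_all _ fun X => indicator_nonneg (fun X _ => hf0 X) X)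
          ((hint.const_mul _).const_mul _) (ae_of_all _ hpt)
    _ ≤ C * (Real.exp (-(s - 2) / ε) * Real.exp (3 / 2 * N)) := by
        have hP : IsProbabilityMeasure W := hZ.isGaussianProcess.isProbabilityMeasure
        obtain ⟨X⟩ : Nonempty Ω := nonempty_of_isProbabilityMeasure W
        have hC : 0 ≤ C := (hf0 X).trans (hfC X)
        rw [integral_const_mul, integral_const_mul]
        gcongr
        exact hZ.integral_exp_sum_le ha0 ha1 N

/-- If `F` obeys the survival bound at every number `N` of dyadic scales between `x - x₀` and `L`,
and the exponential rate `c / ε` per scale exceeds `3`, then `F x = o (x - x₀)`: the rate `3`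
pays for the exponential moment `exp (3 N / 2)` and for `2 ^ N`. -/
lemma tendsto_div_of_survival_bound {F : ℝ → ℝ} {s : ℕ → ℝ} {x₀ c ε L C : ℝ} (hε : 0 < ε)
    (hL : 0 < L) (hC : 0 ≤ C) (hc : 3 * ε < c) (hs : ∀ᶠ N : ℕ in atTop, c * N ≤ s N)
    (hF0 : ∀ x, 0 ≤ F x)
    (hF : ∀ x, x₀ < x → ∀ N : ℕ, 2 ^ N * (x - x₀) ≤ L →
      F x ≤ C * (Real.exp (-(s N - 2) / ε) * Real.exp (3 / 2 * N))) :
    Tendsto (fun x => F x / (x - x₀)) (𝓝[>] x₀) (𝓝 0) := by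
  set q : ℝ := 2 * Real.exp (-(3 / 2)) with hq
  have hq1 : q < 1 := by
    rw [hq, Real.exp_neg, ← div_eq_mul_inv, div_lt_one (Real.exp_pos _)]
    linarith [Real.add_one_le_exp (3 / 2 : ℝ)]
  set K : ℝ := C * Real.exp (2 / ε) * (2 / L) with hK
  have hlim : Tendsto (fun N : ℕ => K * q ^ N) atTop (𝓝 0) := by
    simpa using (tendsto_pow_atTop_nhds_zero_of_lt_one (by positivity) hq1).const_mul K
  rw [Metric.tendsto_nhds]
  intro η hη
  obtain ⟨M, hM⟩ := eventually_atTop.1 (hs.and (hlim.eventually_lt_const hη))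
  filter_upwards [Ioo_mem_nhdsGT (show x₀ < x₀ + L / 2 ^ M by
    have : 0 < L / 2 ^ M := by positivity
    linarith)] with x hx
  have hδ : 0 < x - x₀ := sub_pos.2 hx.1
  have hML : 2 ^ M * (x - x₀) ≤ L := by
    have : x - x₀ ≤ L / 2 ^ M := by linarith [hx.2]
    rwa [le_div_iff₀ (by positivity), mul_comm] at this
  obtain ⟨N, hN1, hN2⟩ := exists_nat_pow_near (x := L / (x - x₀)) (y := 2)
    ((one_le_div hδ).2 (le_trans (le_mul_of_one_le_left hδ.le
      (one_le_pow₀ one_le_two)) hML)) one_lt_two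
  have hMN : M ≤ N := by
    have h : (2 : ℝ) ^ M < 2 ^ (N + 1) := lt_of_le_of_lt ((le_div_iff₀ hδ).2 hML) hN2
    exact Nat.lt_succ_iff.1 ((pow_lt_pow_iff_right₀ one_lt_two).1 h)
  obtain ⟨hsN, hKN⟩ := hM N hMN
  have hrate : Real.exp (-(s N - 2) / ε) * Real.exp (3 / 2 * N) ≤
      Real.exp (2 / ε) * Real.exp (-(3 / 2)) ^ N := by
    rw [← Real.exp_nat_mul, ← Real.exp_add, ← Real.exp_add, Real.exp_le_exp]
    have h3 : (3 : ℝ) * N ≤ s N / ε := by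
      rw [le_div_iff₀ hε]
      nlinarith [(Nat.cast_nonneg N : (0 : ℝ) ≤ N)]
    rw [neg_sub, sub_div]
    linarith
  have hinv : 1 / (x - x₀) ≤ 2 / L * 2 ^ N := by
    rw [div_lt_iff₀ hδ] at hN2
    rw [div_le_iff₀ hδ, div_mul_eq_mul_div, div_mul_eq_mul_div, le_div_iff₀ hL, one_mul]
    calc L ≤ 2 ^ (N + 1) * (x - x₀) := hN2.le
      _ = 2 * 2 ^ N * (x - x₀) := by ring
  rw [Real.dist_0_eq_abs, abs_of_nonneg (div_nonneg (hF0 x) hδ.le)]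
  calc F x / (x - x₀) = F x * (1 / (x - x₀)) := by ring
    _ ≤ (C * (Real.exp (2 / ε) * Real.exp (-(3 / 2)) ^ N)) * (2 / L * 2 ^ N) := by
        gcongr
        exact (hF x hx.1 N ((le_div_iff₀ hδ).1 hN1)).trans (by gcongr)
    _ = K * q ^ N := by rw [hK, hq, mul_pow]; ring
    _ < η := hKN

/-! ### The boundary behaviour of the solutions -/

lemma lt_of_le_lowerHitTime {σ σ₁ x : ℝ} {t s : ℝ≥0} {X y : ℝ≥0 → ℝ} (hs : s < t)
    (h : (t : ℝ≥0∞) ≤ lowerHitTime σ σ₁ t x X y) : σ * y (t - s) < x + σ₁ * X s := by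
  by_contra! hle
  exact absurd (h.trans (iInf₂_le s hle)) (not_le.2 (by exact_mod_cast hs))

lemma lt_of_le_stripExitTime {σ σ₁ x : ℝ} {t s : ℝ≥0} {X y : ℝ≥0 → ℝ} (hs : s < t)
    (h : (t : ℝ≥0∞) ≤ stripExitTime σ σ₁ t x X y) : σ * y (t - s) < x + σ₁ * X s := by
  by_contra! hle
  exact absurd (h.trans (iInf₂_le s fun hmem => absurd hmem.1 (not_lt.2 hle)))
    (not_le.2 (by exact_mod_cast hs))

/-- In a fixed environment `y` whose time reversal at `T` has negative parts growing linearly along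
the dyadic scales, any integral over paths that stay above `σ y` until time `T` is `o (x - σ y T)`.
Both `halfLineSolution` and `stripSolution` are of this form. -/
lemma tendsto_integral_survival_div {W : Measure C(ℝ≥0, ℝ)} (hW : IsWienerMeasure W)
    {σ σ₁ c C : ℝ} (hσ : 0 < σ) (hσ₁ : 0 < σ₁) (hc : 3 * (σ₁ / σ) < c) {T : ℝ≥0} (hT : 0 < T)
    {y : ℝ≥0 → ℝ}
    (hy : ∀ᶠ N : ℕ in atTop, c * N ≤ ∑ k ∈ Finset.range N,
      max (-((y T - y (T - dyadicTime T k)) / √(dyadicTime T k : ℝ))) 0)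
    {g : ℝ → ℝ} (hg0 : ∀ z, 0 ≤ g z) (hgC : ∀ z, g z ≤ C) {S : ℝ → Set C(ℝ≥0, ℝ)}
    (hS : ∀ x, ∀ X ∈ S x, ∀ s < T, σ * y (T - s) < x + σ₁ * X s) :
    Tendsto (fun x => (∫ X, (S x).indicator (fun X => g (x + σ₁ * X T)) X ∂W) / (x - σ * y T))
      (𝓝[>] (σ * y T)) (𝓝 0) := by
  have hsT : 0 < √(T : ℝ) := by positivity
  refine tendsto_div_of_survival_bound (div_pos hσ₁ hσ) (mul_pos hσ hsT)
    ((hg0 0).trans (hgC 0)) hc hy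
    (fun x => integral_nonneg fun X => indicator_nonneg (fun X _ => hg0 _) X)
    fun x hx N hN => ?_
  have hδ : 0 < x - σ * y T := sub_pos.2 hx
  have hr (k : ℕ) : 0 < √(dyadicTime T k : ℝ) := by
    have := dyadicTime_pos hT k
    positivity
  refine integral_survival_le (isDyadicGaussian_brownian hT hW.toIsPreBrownianReal)
    (d := fun k => (x - σ * y T) / (σ * √(dyadicTime T k : ℝ)))
    (fun X => hg0 _) (fun X => hgC _) (div_pos hσ₁ hσ)
    (fun k => div_nonneg hδ.le (mul_pos hσ (hr k)).le) (fun X hX k => ?_) ?_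
  · have h := hS x X hX _ (dyadicTime_lt hT k)
    have hk := hr k
    have heq : (x - σ * y T) / (σ * √(dyadicTime T k : ℝ)) +
        σ₁ / σ * (X (dyadicTime T k) / √(dyadicTime T k : ℝ)) +
        (y T - y (T - dyadicTime T k)) / √(dyadicTime T k : ℝ) =
        (x + σ₁ * X (dyadicTime T k) - σ * y (T - dyadicTime T k)) /
          (σ * √(dyadicTime T k : ℝ)) := by
      field_simp
      ring
    rw [heq]
    exact div_pos (sub_pos.2 h) (mul_pos hσ hk)
  · have hsum : ∑ k ∈ Finset.range N, (x - σ * y T) / (σ * √(dyadicTime T k : ℝ)) =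
        (x - σ * y T) / (σ * √(T : ℝ)) * (2 * (2 ^ N - 1)) := by
      clear hN
      induction N with
      | zero => simp
      | succ N ih =>
        rw [Finset.sum_range_succ, ih, sqrt_dyadicTime, one_div, inv_pow]
        field_simp
        ring
    rw [hsum, div_mul_eq_mul_div, div_le_iff₀ (mul_pos hσ hsT)]
    linarith

end BrownianBoundary

theorem lemma3p2 :
    ∃ ε₀ : ℝ, 0 < ε₀ ∧
      ∀ (σ σ₁ : ℝ), 0 < σ → 0 < σ₁ → σ₁ / σ < ε₀ →
      ∀ (π₀ : ℝ → ℝ), ContDiff ℝ ∞ π₀ → HasCompactSupport π₀ → tsupport π₀ ⊆ Ioo 0 1 →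
        (∀ x, 0 ≤ π₀ x) → (∫ x, π₀ x) = 1 →
      ∀ (W : Measure C(ℝ≥0, ℝ)), BrownianBoundary.IsWienerMeasure W →
      ∀ (Ω : Type*) [MeasurableSpace Ω] (P : Measure Ω) [IsProbabilityMeasure P]
        (b : ℝ≥0 → Ω → ℝ), IsBrownianReal b P →
      ∀ T : ℝ≥0, 0 < T →
        (∀ᵐ w ∂P, Tendsto
          (fun x : ℝ => BrownianBoundary.halfLineSolution W π₀ σ σ₁ (fun t => b t w) T x
            / (x - σ * b T w))
          (𝓝[>] (σ * b T w)) (𝓝 0)) ∧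
        (∀ᵐ w ∂P, Tendsto
          (fun x : ℝ => BrownianBoundary.stripSolution W π₀ σ σ₁ (fun t => b t w) T x
            / (x - σ * b T w))
          (𝓝[>] (σ * b T w)) (𝓝 0)) := by
  have hm := BrownianBoundary.integral_abs_gaussianReal_pos
  refine ⟨(∫ x, |x| ∂gaussianReal 0 (3 / 4)) / 12, by positivity, ?_⟩
  intro σ σ₁ hσ hσ₁ hε π₀ hπ hπc _ hπ0 _ W hW Ω _ P _ b hb T hT
  obtain ⟨C, hC⟩ := hπc.exists_bound_of_continuous hπ.continuous
  have hC' (z : ℝ) : π₀ z ≤ C := (le_abs_self _).trans (hC z)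
  have hg0 (z : ℝ) : 0 ≤ (Ioo (0 : ℝ) 1).indicator π₀ z := indicator_nonneg (fun z _ => hπ0 z) z
  have hgC (z : ℝ) : (Ioo (0 : ℝ) 1).indicator π₀ z ≤ C :=
    indicator_apply_le' (fun _ => hC' z) fun _ => (hπ0 z).trans (hC' z)
  have henv := (BrownianBoundary.isDyadicGaussian_reversal hT
    hb.toIsPreBrownianReal).ae_eventually_le_sum_negPart
  constructor
  · filter_upwards [henv] with w hw
    exact BrownianBoundary.tendsto_integral_survival_div hW hσ hσ₁ (by linarith) hT
      (y := fun t => b t w) hw hg0 hgC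
      fun x X hX s hs => BrownianBoundary.lt_of_le_lowerHitTime hs hX
  · filter_upwards [henv] with w hw
    exact BrownianBoundary.tendsto_integral_survival_div hW hσ hσ₁ (by linarith) hT
      (y := fun t => b t w) hw hg0 hgC
      fun x X hX s hs => BrownianBoundary.lt_of_le_stripExitTime hs hX
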